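/- Let $\Gamma$ be a finite simplicial graph (finite, no loops or multiple edges) whose edges $e$ are labelled by even integers $m_e\ge 2$, and let $$A_\Gamma=\langle V(\Gamma)\mid \langle v,w\rangle^{m_e}=\langle w,v\rangle^{m_e}\text{ for each edge } e=\{v,w\}\rangle$$ be its Artin group, where $\langle v,w\rangle^{m}=vwv\cdots$ is the alternating product of length $m$ starting with $v$. For $T\subseteq V(\Gamma)$ let $A_T$ be the subgroup of $A_\Gamma$ generated by $T$, and let $\Gamma_T$ be the full labelled subgraph spanned by $T$. Call $T$ a clique if any two distinct elements of $T$ are joined by an edge. Then there exist $n\ge 1$, a chain of group homomorphisms $$A_\Gamma\xrightarrow{q_1}A_1\xrightarrow{q_2}A_2\to\cdots\xrightarrow{q_n}A_n$$ and a finite collection of cliques $T_1,\dots,T_p$ of $\Gamma$ (repetitions allowed) such that $\ker q_i$ is a free group (of possibly infinite rank, the trivial group included) for every $i\in\{1,\dots,n\}$ and $$A_n\cong A_{T_1}\times A_{T_2}\times\cdots\times A_{T_p}\cong A_{\Gamma_{T_1}}\times A_{\Gamma_{T_2}}\times\cdots\times A_{\Gamma_{T_p}}.$$ (For $p=0$ the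 product is the trivial group.) -/

import Mathlib

universe u

/-- A simplicial graph on the vertex set `V` whose edges carry integer labels `≥ 2`. Only the
values of `label` on edges matter. -/
structure LabelledGraph (V : Type u) where
  graph : SimpleGraph V
  label : Sym2 V → ℕ
  two_le_label : ∀ e ∈ graph.edgeSet, 2 ≤ label e

/-- The alternating product `a b a ⋯` of length `n` starting with `a`. -/
def altProd {G : Type u} [Group G] (a b : G) : ℕ → G
  | 0 => 1
  | n + 1 => a * altProd b a n

namespace LabelledGraph

variable {V : Type u} (Γ : LabelledGraph V)

/-- All edge labels are even. -/
def IsEven : Prop := ∀ e ∈ Γ.graph.edgeSet, Even (Γ.label e)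

/-- The full labelled subgraph spanned by a set `T` of vertices. -/
def fullSubgraph (T : Set V) : LabelledGraph T where
  graph := Γ.graph.induce T
  label e := Γ.label (e.map Subtype.val)
  two_le_label := by
    intro e
    induction e with
    | _ v w => exact fun h => Γ.two_le_label s(v.1, w.1) h

/-- The relators `⟨v, w⟩ᵐ (⟨w, v⟩ᵐ)⁻¹`, one for each edge `{v, w}` (in both orders), where `m` is
the label of the edge. -/
def artinRels : Set (FreeGroup V) :=
  {r | ∃ v w : V, Γ.graph.Adj v w ∧
    r = altProd (FreeGroup.of v) (FreeGroup.of w) (Γ.label s(v, w)) *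
      (altProd (FreeGroup.of w) (FreeGroup.of v) (Γ.label s(v, w)))⁻¹}

/-- The Artin group of a labelled graph. -/
abbrev ArtinGroup : Type u := PresentedGroup Γ.artinRels

/-- The subgroup of the Artin group generated by a set `T` of vertices. -/
def artinSubgroup (T : Set V) : Subgroup Γ.ArtinGroup :=
  Subgroup.closure (PresentedGroup.of '' T)

end LabelledGraph

/-!
Since the labels are even, killing one end of an edge makes the relation of that edge trivial, so
`A_Γ` retracts onto the Artin group of each full subgraph. If two vertices `v ≠ w` in `U` are not
adjacent, then `A_U` is the amalgam of `A_{U ∖ v}` and `A_{U ∖ w}` along `A_{U ∖ {v, w}}`, and the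
two retractions form a homomorphism `A_U → A_{U ∖ v} × A_{U ∖ w}` which is injective on both
factors. A homomorphism from an amalgam which is injective on the factors has free kernel, and
iterating leads to a product of Artin groups of cliques.

The freeness of the kernel needs no Bass–Serre theory. Let `f : G → Q` be injective on the factors
`G i` of an amalgam `G` over `H`. Choose maps `τ i : Q → G i` equivariant under `G i` and
`σ : Q → H` equivariant under `H`. The Kaloujnine–Krasner embedding `G → G ≀ Q` in the coordinates
`τ i` sends `g ∈ G i` to `f g ∈ Q`; hence in the coordinates `σ` it is, on `G i`, the conjugate of
`f` by the element `x ↦ (σ x)⁻¹ * τ i x` of the base group. Lifting the values of these elements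
from `G` to `FreeGroup G` lifts the whole embedding to a homomorphism `G → FreeGroup G ≀ Q`, and the
coordinate at `1` of this lift embeds `ker f` into `FreeGroup G`.
-/

open Function

section FreeKernel

variable {G H K : Type*} [Group G] [Group H] [Group K]

theorem isFreeGroup_of_injective [IsFreeGroup H] {f : G →* H} (hf : Injective f) :
    IsFreeGroup G :=
  IsFreeGroup.ofMulEquiv (MonoidHom.ofInjective hf).symm

theorem isFreeGroup_ker_of_injective {f : G →* H} (hf : Injective f) : IsFreeGroup f.ker :=
  have : Subsingleton f.ker := by
    rw [(MonoidHom.ker_eq_bot_iff f).2 hf]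
    infer_instance
  isFreeGroup_of_injective (f := (1 : f.ker →* FreeGroup G)) (injective_of_subsingleton _)

theorem isFreeGroup_ker_comp {g : H →* K} {f : G →* H} [IsFreeGroup g.ker]
    (hf : Injective f) : IsFreeGroup (g.comp f).ker :=
  isFreeGroup_of_injective (f := f.subgroupComap g.ker) fun _ _ h =>
    Subtype.ext (hf (congrArg Subtype.val h))

theorem isFreeGroup_ker_prodMap_id {f : G →* H} [IsFreeGroup f.ker] :
    IsFreeGroup (f.prodMap (MonoidHom.id K)).ker := by
  rw [MonoidHom.ker_prodMap, (MonoidHom.ker_eq_bot_iff (MonoidHom.id K)).2 injective_id]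
  exact IsFreeGroup.ofMulEquiv
    (MulEquiv.prodUnique.symm.trans (Subgroup.prodEquiv f.ker (⊥ : Subgroup K)).symm)

end FreeKernel

section Wreath

open RegularWreathProduct

variable {G D E Q : Type*} [Group G] [Group D] [Group E] [Group Q]

/-- The homomorphism of wreath products induced by a homomorphism of the bottom groups. -/
def wreathMap (Q : Type*) [Group Q] (φ : D →* E) : D ≀ᵣ Q →* E ≀ᵣ Q where
  toFun w := ⟨φ ∘ w.left, w.right⟩
  map_one' := by ext <;> simp
  map_mul' a b := by ext <;> simp

theorem wreathMap_inl (φ : D →* E) (q : Q) : wreathMap Q φ (inl q) = inl q := by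
  ext <;> simp [wreathMap]

theorem wreathMap_conj_inl (φ : D →* E) (t : Q → D) (q : Q) :
    wreathMap Q φ (MulAut.conj ⟨t, 1⟩ (inl q)) = MulAut.conj ⟨φ ∘ t, 1⟩ (inl q) := by
  ext <;> simp [wreathMap]

theorem commute_inl_of_forall_apply_mul_eq {f : Q → D} {q : Q} (h : ∀ x, f (q * x) = f x) :
    Commute (⟨f, 1⟩ : D ≀ᵣ Q) (inl q) := by
  ext x
  · simpa using h (q⁻¹ * x)
  · simp

/-- The Kaloujnine–Krasner homomorphism of `π` in the coordinates given by `σ`. It is the conjugate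
of the diagonal embedding by `σ`, regarded as an element of the base group, so `σ` need not be a
section of `π`. -/
def krasnerHom (π : G →* Q) (σ : Q → G) : G →* G ≀ᵣ Q where
  toFun g := ⟨fun x => (σ x)⁻¹ * g * σ ((π g)⁻¹ * x), π g⟩
  map_one' := by ext <;> simp
  map_mul' g h := by ext <;> simp [mul_assoc]

theorem krasnerHom_eq_inl {π : G →* Q} {σ : Q → G} {g : G} (h : ∀ x, σ (π g * x) = g * σ x) :
    krasnerHom π σ g = inl (π g) := by
  ext x
  · simpa [krasnerHom, inv_mul_eq_one, mul_assoc] using h ((π g)⁻¹ * x)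
  · rfl

theorem krasnerHom_eq_conj (π : G →* Q) (σ τ : Q → G) (g : G) :
    krasnerHom π σ g = MulAut.conj (⟨fun x => (σ x)⁻¹ * τ x, 1⟩ : G ≀ᵣ Q) (krasnerHom π τ g) := by
  ext <;> simp [krasnerHom, mul_assoc]

theorem isFreeGroup_ker_of_wreathMap_comp_eq_krasnerHom [IsFreeGroup D] {π : G →* Q} {σ : Q → G}
    {φ : D →* G} {Ψ : G →* D ≀ᵣ Q} (h : (wreathMap Q φ).comp Ψ = krasnerHom π σ) :
    IsFreeGroup π.ker := by
  have right_eq (n : π.ker) : (Ψ n).right = 1 :=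
    (congrArg RegularWreathProduct.right (DFunLike.congr_fun h (n : G))).trans n.2
  have left_eq (n : π.ker) : φ ((Ψ n).left 1) = (σ 1)⁻¹ * n * σ 1 := by
    have := congrFun (congrArg RegularWreathProduct.left (DFunLike.congr_fun h (n : G))) 1
    simpa [wreathMap, krasnerHom, MonoidHom.mem_ker.1 n.2] using this
  let leftAtOne : π.ker →* D :=
    { toFun n := (Ψ n).left 1
      map_one' := by simp
      map_mul' m n := by simp [right_eq] }
  refine isFreeGroup_of_injective (f := leftAtOne) fun m n hmn => Subtype.ext ?_
  have := (left_eq m).symm.trans ((congrArg φ hmn).trans (left_eq n))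
  simpa using this

end Wreath

section Pushout

open Monoid PushoutI RegularWreathProduct

theorem exists_equivariant_of_injective {A Q : Type*} [Group A] [Group Q] {π : A →* Q}
    (hπ : Injective π) :
    ∃ ρ : Q → A, ∀ a x, ρ (π a * x) = a * ρ x := by
  obtain ⟨T, hT, -⟩ := π.range.exists_isComplement_right 1
  let e := MonoidHom.ofInjective hπ
  refine ⟨fun x => e.symm (hT.equiv x).1, fun a x => ?_⟩
  change e.symm (hT.equiv (e a * x)).1 = _
  rw [hT.equiv_mul_left, map_mul, e.symm_apply_apply]

theorem isFreeGroup_ker_of_injective_on_factors {ι H Q : Type*} {G : ι → Type*} [Group H] [Group Q]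
    [∀ i, Group (G i)] {φ : ∀ i, H →* G i} {f : PushoutI φ →* Q}
    (hbase : Injective (f.comp (base φ))) (hof : ∀ i, Injective (f.comp (of i))) :
    IsFreeGroup f.ker := by
  obtain ⟨ρ, hρ⟩ := exists_equivariant_of_injective hbase
  choose r hr using fun i => exists_equivariant_of_injective (hof i)
  let σ (x : Q) : PushoutI φ := base φ (ρ x)
  let τ (i : ι) (x : Q) : PushoutI φ := of i (r i x)
  have hσ (h x) : σ (f (base φ h) * x) = base φ h * σ x := by
    simpa [σ] using congrArg (base φ) (hρ h x)
  have hτ (i g x) : τ i (f (of i g) * x) = of i g * τ i x := by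
    simpa [τ] using congrArg (of i) (hr i g x)
  -- Labelling the free generators by the values `(σ x)⁻¹ * τ i x`, and not by the pairs `(i, x)`,
  -- is what makes `c i` commute with the image of the base.
  let c (i : ι) : FreeGroup (PushoutI φ) ≀ᵣ Q := ⟨fun x => FreeGroup.of ((σ x)⁻¹ * τ i x), 1⟩
  have hc (i h) : Commute (c i) (inl (f (base φ h))) :=
    commute_inl_of_forall_apply_mul_eq fun x => by
      rw [hσ, ← of_apply_eq_base φ i, hτ]
      group
  let Ψ : PushoutI φ →* FreeGroup (PushoutI φ) ≀ᵣ Q :=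
    lift (fun i => (MulAut.conj (c i)).toMonoidHom.comp (inl.comp (f.comp (of i))))
      (inl.comp (f.comp (base φ))) fun i => by
        ext1 h
        simpa [of_apply_eq_base] using mul_inv_eq_of_eq_mul (hc i h)
  refine isFreeGroup_ker_of_wreathMap_comp_eq_krasnerHom (σ := σ) (φ := FreeGroup.lift id) (Ψ := Ψ)
    (hom_ext (fun i => ?_) ?_)
  · ext1 g
    calc wreathMap Q (FreeGroup.lift id) (Ψ (of i g))
      _ = wreathMap Q (FreeGroup.lift id) (MulAut.conj (c i) (inl (f (of i g)))) := by
        simp [Ψ]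
      _ = MulAut.conj ⟨fun x => (σ x)⁻¹ * τ i x, 1⟩ (inl (f (of i g))) :=
        wreathMap_conj_inl _ _ _
      _ = krasnerHom f σ (of i g) := by
        rw [krasnerHom_eq_conj f σ (τ i), krasnerHom_eq_inl (hτ i g)]
  · ext1 h
    simp [Ψ, krasnerHom_eq_inl (hσ h), wreathMap_inl]

end Pushout

section AltProd

variable {G H : Type*} [Group G] [Group H]

theorem map_altProd (f : G →* H) (a b : G) (n : ℕ) :
    f (altProd a b n) = altProd (f a) (f b) n := by
  induction n generalizing a b with
  | zero => exact map_one f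
  | succ n ih => rw [altProd, altProd, map_mul, ih]

theorem altProd_add_self (a b : G) (n : ℕ) : altProd a b (n + n) = (a * b) ^ n := by
  induction n with
  | zero => exact (pow_zero _).symm
  | succ n ih => rw [Nat.add_add_add_comm, altProd, altProd, ih, pow_succ', mul_assoc]

theorem altProd_one_comm {n : ℕ} (hn : Even n) (a : G) : altProd a 1 n = altProd 1 a n := by
  obtain ⟨k, rfl⟩ := hn
  rw [altProd_add_self, altProd_add_self, mul_one, one_mul]

end AltProd

namespace LabelledGraph

section Generators

variable {V : Type*} (Γ : LabelledGraph V)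

/-- A vertex of the graph as a generator of its Artin group. -/
def artinOf (v : V) : Γ.ArtinGroup := PresentedGroup.of v

variable {Γ} {G : Type*} [Group G]

theorem altProd_artinOf {v w : V} (h : Γ.graph.Adj v w) :
    altProd (Γ.artinOf v) (Γ.artinOf w) (Γ.label s(v, w)) =
      altProd (Γ.artinOf w) (Γ.artinOf v) (Γ.label s(v, w)) := by
  have := PresentedGroup.mk_eq_mk_of_mul_inv_mem (rels := Γ.artinRels) ⟨v, w, h, rfl⟩
  rwa [map_altProd, map_altProd] at this

theorem altProd_map_artinOf (f : Γ.ArtinGroup →* G) {v w : V} (h : Γ.graph.Adj v w) :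
    altProd (f (Γ.artinOf v)) (f (Γ.artinOf w)) (Γ.label s(v, w)) =
      altProd (f (Γ.artinOf w)) (f (Γ.artinOf v)) (Γ.label s(v, w)) := by
  rw [← map_altProd, ← map_altProd, altProd_artinOf h]

/-- The homomorphism out of an Artin group with prescribed values on the vertices. -/
def artinLift (f : V → G)
    (hf : ∀ v w, Γ.graph.Adj v w →
      altProd (f v) (f w) (Γ.label s(v, w)) = altProd (f w) (f v) (Γ.label s(v, w))) :
    Γ.ArtinGroup →* G :=
  PresentedGroup.toGroup (f := f) <| by
    rintro _ ⟨v, w, h, rfl⟩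
    simp only [map_mul, map_inv, map_altProd, FreeGroup.lift_apply_of, hf v w h, mul_inv_cancel]

@[simp]
theorem artinLift_artinOf (f : V → G) (hf) (v : V) :
    artinLift (Γ := Γ) f hf (Γ.artinOf v) = f v :=
  PresentedGroup.toGroup.of _

theorem artinHom_ext {f g : Γ.ArtinGroup →* G}
    (h : ∀ v, f (Γ.artinOf v) = g (Γ.artinOf v)) : f = g :=
  PresentedGroup.ext h

end Generators

section FullSubgraph

variable {V : Type*} {Γ : LabelledGraph V}

variable (Γ) in
/-- The homomorphism from the Artin group of a full subgraph to the Artin group of the graph. -/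
def artinIncl (T : Set V) : (Γ.fullSubgraph T).ArtinGroup →* Γ.ArtinGroup :=
  artinLift (fun v => Γ.artinOf v.1) fun _ _ h => altProd_artinOf h

@[simp]
theorem artinIncl_artinOf {T : Set V} (v : T) :
    Γ.artinIncl T ((Γ.fullSubgraph T).artinOf v) = Γ.artinOf v.1 :=
  artinLift_artinOf _ _ _

theorem range_artinIncl (T : Set V) : (Γ.artinIncl T).range = Γ.artinSubgroup T := by
  rw [MonoidHom.range_eq_map, ← PresentedGroup.closure_range_of, MonoidHom.map_closure,
    ← Set.range_comp, artinSubgroup, Set.image_eq_range]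
  exact congrArg Subgroup.closure (congrArg Set.range (funext artinIncl_artinOf))

variable (hΓ : Γ.IsEven)

open Classical in
/-- The homomorphism onto the Artin group of a full subgraph that kills the other vertices. It
exists because, for even `m`, the relation `⟨v, w⟩ᵐ = ⟨w, v⟩ᵐ` holds trivially as soon as `v` or
`w` is killed. -/
noncomputable def artinProj (T : Set V) : Γ.ArtinGroup →* (Γ.fullSubgraph T).ArtinGroup :=
  artinLift (fun v => if h : v ∈ T then (Γ.fullSubgraph T).artinOf ⟨v, h⟩ else 1) <| by
    intro v w h
    have hm : Even (Γ.label s(v, w)) := hΓ _ h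
    by_cases hv : v ∈ T <;> by_cases hw : w ∈ T <;> simp only [hv, hw, dite_true, dite_false]
    · exact altProd_artinOf (Γ := Γ.fullSubgraph T) (v := ⟨v, hv⟩) (w := ⟨w, hw⟩) h
    · exact altProd_one_comm hm _
    · exact (altProd_one_comm hm _).symm

theorem artinProj_artinOf_of_mem {T : Set V} {v : V} (hv : v ∈ T) :
    artinProj hΓ T (Γ.artinOf v) = (Γ.fullSubgraph T).artinOf ⟨v, hv⟩ :=
  (artinLift_artinOf _ _ _).trans (dif_pos hv)

theorem artinProj_artinOf_of_notMem {T : Set V} {v : V} (hv : v ∉ T) :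
    artinProj hΓ T (Γ.artinOf v) = 1 :=
  (artinLift_artinOf _ _ _).trans (dif_neg hv)

/-- The homomorphism from the Artin group of one full subgraph to that of another which keeps the
common vertices and kills the other ones: an inclusion if `S ⊆ T`, a retraction if `T ⊆ S`. -/
noncomputable def artinRes (S T : Set V) :
    (Γ.fullSubgraph S).ArtinGroup →* (Γ.fullSubgraph T).ArtinGroup :=
  (artinProj hΓ T).comp (Γ.artinIncl S)

theorem artinRes_artinOf_of_mem {S T : Set V} {v : S} (hv : v.1 ∈ T) :
    artinRes hΓ S T ((Γ.fullSubgraph S).artinOf v) = (Γ.fullSubgraph T).artinOf ⟨v, hv⟩ := by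
  rw [artinRes, MonoidHom.comp_apply, artinIncl_artinOf, artinProj_artinOf_of_mem]

theorem artinRes_artinOf_of_notMem {S T : Set V} {v : S} (hv : v.1 ∉ T) :
    artinRes hΓ S T ((Γ.fullSubgraph S).artinOf v) = 1 := by
  rw [artinRes, MonoidHom.comp_apply, artinIncl_artinOf, artinProj_artinOf_of_notMem hΓ hv]

theorem artinRes_self (T : Set V) : artinRes hΓ T T = MonoidHom.id _ :=
  artinHom_ext fun v => artinRes_artinOf_of_mem hΓ v.2

theorem artinRes_comp_artinRes {S T U : Set V} (h : S ∩ U ⊆ T) :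
    (artinRes hΓ T U).comp (artinRes hΓ S T) = artinRes hΓ S U := by
  refine artinHom_ext fun v => ?_
  rw [MonoidHom.comp_apply]
  by_cases hU : v.1 ∈ U
  · have hT : v.1 ∈ T := h ⟨v.2, hU⟩
    rw [artinRes_artinOf_of_mem hΓ hT, artinRes_artinOf_of_mem hΓ (v := v) hU]
    exact artinRes_artinOf_of_mem hΓ (v := ⟨v, hT⟩) hU
  · rw [artinRes_artinOf_of_notMem hΓ (v := v) hU]
    by_cases hT : v.1 ∈ T
    · rw [artinRes_artinOf_of_mem hΓ hT]
      exact artinRes_artinOf_of_notMem hΓ (v := ⟨v, hT⟩) hU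
    · rw [artinRes_artinOf_of_notMem hΓ hT, map_one]

theorem artinRes_leftInverse {S T : Set V} (h : S ⊆ T) :
    LeftInverse (artinRes hΓ T S) (artinRes hΓ S T) := fun x =>
  DFunLike.congr_fun ((artinRes_comp_artinRes hΓ (Set.inter_subset_left.trans h)).trans
    (artinRes_self hΓ S)) x

include hΓ in
theorem artinIncl_injective (T : Set V) : Injective (Γ.artinIncl T) :=
  LeftInverse.injective (g := artinProj hΓ T) fun x =>
    DFunLike.congr_fun (artinRes_self hΓ T) x

theorem artinProj_univ_injective : Injective (artinProj hΓ Set.univ) := by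
  have : (Γ.artinIncl Set.univ).comp (artinProj hΓ Set.univ) = MonoidHom.id _ :=
    artinHom_ext fun v => by simp [artinProj_artinOf_of_mem hΓ (Set.mem_univ v)]
  exact LeftInverse.injective (g := Γ.artinIncl Set.univ) (DFunLike.congr_fun this)

/-- The subgroup `A_T` generated by the vertices in `T` is the Artin group of the full subgraph. -/
noncomputable def artinSubgroupEquiv (T : Set V) :
    (Γ.fullSubgraph T).ArtinGroup ≃* Γ.artinSubgroup T :=
  (MonoidHom.ofInjective (artinIncl_injective hΓ T)).trans
    (MulEquiv.subgroupCongr (range_artinIncl T))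

end FullSubgraph

section Splitting

variable {V ι : Type*} (Γ : LabelledGraph V)

/-- The full subgraph on `U` is the union of the full subgraphs on the sets `S i`, any two of which
meet inside `S₀`, so that its Artin group is the amalgam of theirs along that of `S₀`. -/
structure IsSplitting (U S₀ : Set V) (S : ι → Set V) : Prop where
  base_subset : ∀ i, S₀ ⊆ S i
  inter_subset : Pairwise fun i j => S i ∩ S j ⊆ S₀
  iUnion_eq : ⋃ i, S i = U
  exists_mem_of_adj : ∀ v ∈ U, ∀ w ∈ U, Γ.graph.Adj v w → ∃ i, v ∈ S i ∧ w ∈ S i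

variable {Γ}

theorem isSplitting_of_not_adj {U : Set V} {v w : V} (hvw : v ≠ w)
    (hadj : ¬ Γ.graph.Adj v w) :
    Γ.IsSplitting U (U \ {v, w}) fun b : Bool => cond b (U \ {v}) (U \ {w}) where
  base_subset := by grind
  inter_subset := by
    intro i j hij
    cases i <;> cases j <;> grind
  iUnion_eq := by
    rw [← Set.union_eq_iUnion]
    grind
  exists_mem_of_adj := by
    simp only [Bool.exists_bool, cond_true, cond_false]
    intro x hx y hy hxy
    have : ¬ (x = v ∧ y = w) := by grind
    have : ¬ (x = w ∧ y = v) := by grind [SimpleGraph.Adj.symm]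
    grind [SimpleGraph.Adj.ne]

namespace IsSplitting

open Monoid PushoutI

variable (hΓ : Γ.IsEven) {U S₀ : Set V} {S : ι → Set V} (h : Γ.IsSplitting U S₀ S)

include h in
theorem pushout_of_artinOf_eq {v : V} {i j : ι} (hi : v ∈ S i) (hj : v ∈ S j) :
    (of i ((Γ.fullSubgraph (S i)).artinOf ⟨v, hi⟩) : PushoutI fun i => artinRes hΓ S₀ (S i)) =
      of j ((Γ.fullSubgraph (S j)).artinOf ⟨v, hj⟩) := by
  by_cases hij : i = j
  · subst hij
    rfl
  · have hv : v ∈ S₀ := h.inter_subset hij ⟨hi, hj⟩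
    rw [← artinRes_artinOf_of_mem hΓ (v := ⟨v, hv⟩) hi,
      ← artinRes_artinOf_of_mem hΓ (v := ⟨v, hv⟩) hj, of_apply_eq_base, of_apply_eq_base]

include h in
theorem exists_mem (v : U) : ∃ i, v.1 ∈ S i := by
  simpa only [Set.mem_iUnion] using h.iUnion_eq.ge v.2

/-- The homomorphism from the Artin group of a split graph to the amalgam of the Artin groups of
the pieces. -/
noncomputable def toPushout :
    (Γ.fullSubgraph U).ArtinGroup →* PushoutI fun i => artinRes hΓ S₀ (S i) :=
  artinLift (fun v => of _ ((Γ.fullSubgraph _).artinOf ⟨v.1, (h.exists_mem v).choose_spec⟩)) <| by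
    intro v w hvw
    obtain ⟨i, hv, hw⟩ := h.exists_mem_of_adj v v.2 w w.2 hvw
    rw [h.pushout_of_artinOf_eq hΓ _ hv, h.pushout_of_artinOf_eq hΓ _ hw]
    exact altProd_map_artinOf (Γ := Γ.fullSubgraph (S i)) _ (v := ⟨v, hv⟩) (w := ⟨w, hw⟩) hvw

/-- The homomorphism from the amalgam of the Artin groups of the pieces of a split graph to its
Artin group. -/
noncomputable def ofPushout :
    (PushoutI fun i => artinRes hΓ S₀ (S i)) →* (Γ.fullSubgraph U).ArtinGroup :=
  lift (fun i => artinRes hΓ (S i) U) (artinRes hΓ S₀ U) fun i =>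
    artinRes_comp_artinRes hΓ (Set.inter_subset_left.trans (h.base_subset i))

theorem ofPushout_comp_toPushout : (h.ofPushout hΓ).comp (h.toPushout hΓ) = MonoidHom.id _ :=
  artinHom_ext fun v => by
    rw [MonoidHom.comp_apply, toPushout, artinLift_artinOf, ofPushout, lift_of]
    exact artinRes_artinOf_of_mem hΓ (T := U) v.2

include h in
theorem isFreeGroup_ker [Nonempty ι] {Q : Type*} [Group Q]
    {f : (Γ.fullSubgraph U).ArtinGroup →* Q}
    (hf : ∀ i, Injective (f.comp (artinRes hΓ (S i) U))) : IsFreeGroup f.ker := by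
  have hof (i) : (f.comp (h.ofPushout hΓ)).comp (of i) = f.comp (artinRes hΓ (S i) U) := by
    ext1 x
    simp [ofPushout]
  have hbase (i : ι) : Injective ((f.comp (h.ofPushout hΓ)).comp (base _)) := by
    rw [← of_comp_eq_base i, ← MonoidHom.comp_assoc, hof]
    exact (hf i).comp (artinRes_leftInverse hΓ (h.base_subset i)).injective
  have hker : IsFreeGroup (f.comp (h.ofPushout hΓ)).ker :=
    isFreeGroup_ker_of_injective_on_factors (hbase (Classical.arbitrary ι)) fun i => hof i ▸ hf i
  have hinj : Injective (h.toPushout hΓ) :=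
    LeftInverse.injective (DFunLike.congr_fun (h.ofPushout_comp_toPushout hΓ))
  have hcomp : (f.comp (h.ofPushout hΓ)).comp (h.toPushout hΓ) = f := by
    rw [MonoidHom.comp_assoc, ofPushout_comp_toPushout, MonoidHom.comp_id]
  exact hcomp ▸ isFreeGroup_ker_comp hinj

end IsSplitting

theorem isFreeGroup_ker_artinRes_prod (hΓ : Γ.IsEven) {U : Set V} {v w : V}
    (hvw : v ≠ w) (hadj : ¬ Γ.graph.Adj v w) :
    IsFreeGroup ((artinRes hΓ U (U \ {v})).prod (artinRes hΓ U (U \ {w}))).ker := by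
  refine (isSplitting_of_not_adj hvw hadj).isFreeGroup_ker hΓ (Bool.forall_bool.2 ⟨?_, ?_⟩)
  · exact LeftInverse.injective (g := Prod.snd) (artinRes_leftInverse hΓ Set.sdiff_subset)
  · exact LeftInverse.injective (g := Prod.fst) (artinRes_leftInverse hΓ Set.sdiff_subset)

end Splitting

end LabelledGraph

section FreeChain

open CategoryTheory Relation

/-- The relation on groups of admitting a homomorphism with free kernel from the first to the
second. -/
def FreeKernelStep (G H : GrpCat.{u}) : Prop := ∃ f : G →* H, IsFreeGroup f.ker

/-- The relation on groups of being linked by a finite chain of homomorphisms with free kernels. -/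
def FreeKernelChain (G H : Type u) [Group G] [Group H] : Prop :=
  ReflTransGen FreeKernelStep (GrpCat.of G) (GrpCat.of H)

namespace FreeKernelChain

variable {G H K L : Type u} [Group G] [Group H] [Group K] [Group L]

theorem of_hom {f : G →* H} (hf : IsFreeGroup f.ker) : FreeKernelChain G H :=
  .single ⟨f, hf⟩

theorem of_mulEquiv (e : G ≃* H) : FreeKernelChain G H :=
  of_hom (isFreeGroup_ker_of_injective (f := e.toMonoidHom) e.injective)

theorem trans (h₁ : FreeKernelChain G H) (h₂ : FreeKernelChain H K) : FreeKernelChain G K :=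
  ReflTransGen.trans h₁ h₂

theorem prod_right (h : FreeKernelChain G H) (K : Type u) [Group K] :
    FreeKernelChain (G × K) (H × K) :=
  ReflTransGen.lift (r := FreeKernelStep) (p := FreeKernelStep)
    (fun A : GrpCat.{u} => GrpCat.of (A × K))
    (fun _ _ ⟨f, _⟩ => ⟨f.prodMap (.id K), isFreeGroup_ker_prodMap_id⟩) _ _ h

theorem prod (h₁ : FreeKernelChain G H) (h₂ : FreeKernelChain K L) :
    FreeKernelChain (G × K) (H × L) :=
  (h₁.prod_right K).trans <| (of_mulEquiv .prodComm).trans <|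
    (h₂.prod_right H).trans (of_mulEquiv .prodComm)

end FreeKernelChain

theorem exists_relSeries_of_reflTransGen {α : Type*} {r : SetRel α α} {a b : α}
    (h : ReflTransGen (fun x y => (x, y) ∈ r) a b) :
    ∃ s : RelSeries r, s.head = a ∧ s.last = b := by
  induction h using ReflTransGen.head_induction_on with
  | refl => exact ⟨.singleton r b, rfl, rfl⟩
  | @head a _ hab _ ih =>
    obtain ⟨s, rfl, rfl⟩ := ih
    exact ⟨s.cons a hab, s.head_cons a hab, s.last_cons a hab⟩

theorem FreeKernelChain.exists_fin {G H : Type u} [Group G] [Group H] (h : FreeKernelChain G H) :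
    ∃ (n : ℕ) (A : Fin (n + 1) → GrpCat.{u}) (q : ∀ i : Fin n, A i.castSucc →* A i.succ),
      (∀ i, IsFreeGroup (q i).ker) ∧ Nonempty (G ≃* A 0) ∧ Nonempty (A (Fin.last n) ≃* H) := by
  obtain ⟨s, hG, hH⟩ :=
    exists_relSeries_of_reflTransGen (r := {p | FreeKernelStep p.1 p.2}) h
  choose q hq using s.step
  exact ⟨s.length, s, q, hq, ⟨(eqToIso hG.symm).groupIsoToMulEquiv⟩,
    ⟨(eqToIso hH).groupIsoToMulEquiv⟩⟩

end FreeChain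

theorem LabelledGraph.exists_freeKernelChain {V : Type u} [Finite V] {Γ : LabelledGraph V}
    (hΓ : Γ.IsEven) (U : Set V) :
    ∃ (ι : Type) (_ : Finite ι) (T : ι → Set V), (∀ j, Γ.graph.IsClique (T j)) ∧
      FreeKernelChain (Γ.fullSubgraph U).ArtinGroup (∀ j, (Γ.fullSubgraph (T j)).ArtinGroup) := by
  induction U using WellFoundedLT.induction with
  | ind U ih =>
    by_cases hU : Γ.graph.IsClique U
    · exact ⟨Unit, inferInstance, fun _ => U, fun _ => hU, .of_mulEquiv
        (MulEquiv.piUnique fun _ : Unit => (Γ.fullSubgraph U).ArtinGroup).symm⟩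
    · obtain ⟨v, hv, w, hw, hvw, hadj⟩ : ∃ v ∈ U, ∃ w ∈ U, v ≠ w ∧ ¬ Γ.graph.Adj v w := by
        simpa [SimpleGraph.isClique_iff, Set.Pairwise] using hU
      obtain ⟨ι, _, S, hS, hchainS⟩ := ih (U \ {v}) (Set.sdiff_singleton_ssubset.2 hv)
      obtain ⟨κ, _, T, hT, hchainT⟩ := ih (U \ {w}) (Set.sdiff_singleton_ssubset.2 hw)
      let e : (∀ j, (Γ.fullSubgraph (Sum.elim S T j)).ArtinGroup) ≃*
          (∀ j, (Γ.fullSubgraph (S j)).ArtinGroup) × (∀ j, (Γ.fullSubgraph (T j)).ArtinGroup) :=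
        { Equiv.sumPiEquivProdPi _ with map_mul' _ _ := rfl }
      exact ⟨ι ⊕ κ, inferInstance, Sum.elim S T, Sum.rec hS hT,
        (FreeKernelChain.of_hom (isFreeGroup_ker_artinRes_prod hΓ hvw hadj)).trans <|
          (hchainS.prod hchainT).trans (.of_mulEquiv e.symm)⟩

/-- The chain is `A_Γ → A 0 → A 1 → ⋯ → A n`, given by the map `q₀` followed by the maps `q i`.
The last group is a direct product of groups `A_T` over cliques `T`, where `A_T` is the subgroup of
`A_Γ` generated by `T`, and equally the Artin group of the full subgraph spanned by `T`. -/
theorem mainTheorem5 {V : Type u} [Finite V] (Γ : LabelledGraph V) (hΓ : Γ.IsEven) :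
    ∃ (n : ℕ) (A : Fin (n + 1) → Type u) (_ : ∀ i, Group (A i))
      (q₀ : Γ.ArtinGroup →* A 0) (q : ∀ i : Fin n, A i.castSucc →* A i.succ)
      (p : ℕ) (T : Fin p → Set V),
      IsFreeGroup q₀.ker ∧
      (∀ i, IsFreeGroup (q i).ker) ∧
      (∀ j, Γ.graph.IsClique (T j)) ∧
      Nonempty (A (Fin.last n) ≃* (∀ j, Γ.artinSubgroup (T j))) ∧
      Nonempty (A (Fin.last n) ≃* (∀ j, (Γ.fullSubgraph (T j)).ArtinGroup)) := by
  obtain ⟨ι, _, T, hT, hchain⟩ := LabelledGraph.exists_freeKernelChain hΓ Set.univ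
  obtain ⟨n, A, q, hq, ⟨e₀⟩, ⟨e⟩⟩ := hchain.exists_fin
  obtain ⟨p, ⟨ε⟩⟩ := Finite.exists_equiv_fin ι
  let eFin : (∀ j, (Γ.fullSubgraph (T j)).ArtinGroup) ≃*
      ∀ j, (Γ.fullSubgraph (T (ε.symm j))).ArtinGroup :=
    { Equiv.piCongrLeft' _ ε with map_mul' _ _ := rfl }
  let q₀ : Γ.ArtinGroup →* A 0 := e₀.toMonoidHom.comp (LabelledGraph.artinProj hΓ Set.univ)
  have hq₀ : Injective q₀ := e₀.injective.comp (LabelledGraph.artinProj_univ_injective hΓ)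
  exact ⟨n, fun i => A i, fun i => inferInstance, q₀, q, p, fun j => T (ε.symm j),
    isFreeGroup_ker_of_injective hq₀, hq, fun j => hT (ε.symm j),
    ⟨(e.trans eFin).trans (.piCongrRight fun _ => LabelledGraph.artinSubgroupEquiv hΓ _)⟩,
    ⟨e.trans eFin⟩⟩
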